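/- Consider a $k$-commodity flow problem: a finite undirected graph $G=(V,E)$ with edge capacities $c_e\ge 0$, and $k\ge 2$ source-sink pairs $s_i\neq t_i$ of vertices with demands $D_i>0$, $i=1,\dots,k$ (the vertices in different pairs need not be distinct). Let $\max\phi$ be the largest $\phi\ge 0$ for which it is possible to flow $\phi D_i$ of the $i$-th commodity from $s_i$ to $t_i$, simultaneously for all $i$, so that commodity $i$ is conserved at every vertex other than $s_i$ and $t_i$, and the total flow of all commodities through each edge, added over both directions, is at most its capacity. For $S\subseteq V$, let $\mathrm{cap}(S)$ be the sum of the capacities of the edges between $S$ and $V\setminus S$, let $\mathrm{dem}(S)$ be the sum of $D_i$ over all $i$ such that $S$ contains exactly one of $s_i,t_i$, and, if $\mathrm{dem}(S)>0$, let $\gamma(S)=\mathrm{cap}(S)/\mathrm{dem}(S)$. Theorem. There is a universal constant $c>0$ such that in every $k$-commodity flow problem with $k\ge 2$ the maximum $\max\phi$ and the minimum $\min_S\gamma(S)$ over all $S\subseteq V$ with $\mathrm{dem}(S)>0$ exist, and $$\max\phi\ \ge\ c\cdot\frac{\min_S\gamma(S)}{\log k}.$$ -/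

import Mathlib

/-- A `k`-commodity flow problem: an undirected graph whose edges have nonnegative capacities, with
`k` source-sink pairs of distinct vertices and a positive demand for each of them. Only the values
of `cap` on edges of the graph are ever used. -/
structure CommodityNetwork (V : Type*) (k : ℕ) where
  graph : SimpleGraph V
  cap : Sym2 V → ℝ
  cap_nonneg : ∀ e ∈ graph.edgeSet, 0 ≤ cap e
  source : Fin k → V
  sink : Fin k → V
  source_ne_sink : ∀ i, source i ≠ sink i
  demand : Fin k → ℝ
  demand_pos : ∀ i, 0 < demand i

namespace CommodityNetwork

variable {V : Type*} [Fintype V] {k : ℕ}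

/-- `f i u v` is the amount of commodity `i` sent along the edge `uv` from `u` to `v`. The flow `f`
ships `φ * demand i` of commodity `i` from `source i` to `sink i`, simultaneously for all `i`. -/
structure IsConcurrentFlow (N : CommodityNetwork V k) (φ : ℝ) (f : Fin k → V → V → ℝ) : Prop where
  nonneg : ∀ i u v, 0 ≤ f i u v
  /-- Matter moves only along edges of the graph. -/
  eq_zero_of_not_adj : ∀ i u v, ¬ N.graph.Adj u v → f i u v = 0
  /-- Each commodity is conserved at every vertex other than its source and its sink. -/
  conservation : ∀ i v, v ≠ N.source i → v ≠ N.sink i → ∑ u, f i u v = ∑ u, f i v u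
  /-- The net amount of commodity `i` leaving its source. By conservation, this is also the net
  amount that enters its sink. -/
  value : ∀ i, ∑ v, f i (N.source i) v - ∑ v, f i v (N.source i) = φ * N.demand i
  /-- The total flow through an edge, of all commodities and in both directions, is at most its
  capacity. -/
  capacity : ∀ u v, N.graph.Adj u v → ∑ i, (f i u v + f i v u) ≤ N.cap s(u, v)

/-- The values `φ ≥ 0` that some concurrent flow achieves. -/
def flowValues (N : CommodityNetwork V k) : Set ℝ :=
  {φ | 0 ≤ φ ∧ ∃ f, N.IsConcurrentFlow φ f}

/-- `S` separates `u` and `v` if it contains exactly one of them. -/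
def Separates (S : Finset V) (u v : V) : Prop :=
  (u ∈ S ∧ v ∉ S) ∨ (u ∉ S ∧ v ∈ S)

open Classical in
/-- The sum of the capacities of the edges between `S` and its complement. Every such edge is
counted once, through its end `u` in `S`. -/
noncomputable def cutCap (N : CommodityNetwork V k) (S : Finset V) : ℝ :=
  ∑ u ∈ S, ∑ v ∈ Sᶜ, if N.graph.Adj u v then N.cap s(u, v) else 0

open Classical in
/-- The sum of the demands of the source-sink pairs that `S` separates. -/
noncomputable def cutDem (N : CommodityNetwork V k) (S : Finset V) : ℝ :=
  ∑ i, if Separates S (N.source i) (N.sink i) then N.demand i else 0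

/-- The ratio of a cut. It is meaningful only if `S` separates some source-sink pair. -/
noncomputable def cutRatio (N : CommodityNetwork V k) (S : Finset V) : ℝ :=
  N.cutCap S / N.cutDem S

/-- The ratios of all cuts that separate at least one source-sink pair. -/
def cutRatios (N : CommodityNetwork V k) : Set ℝ :=
  {r | ∃ S : Finset V, (∃ i, Separates S (N.source i) (N.sink i)) ∧ N.cutRatio S = r}

end CommodityNetwork

/-!
The maximum concurrent flow is at least a constant times the minimum cut ratio over `log k`.

Let `γ` be the minimum cut ratio and suppose that the value `φ = γ / (24 J)` is not achieved, where
`2 k < 2 ^ J`. The net outflows of all flows within the capacities form a compact convex set, which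
misses the demand vector scaled by `φ`. A separating functional consists of a potential for each
commodity. Together the potentials map the vertices into `ℝᵏ` with the supremum metric `d`. The flow
that uses each edge for the commodity with the largest drop of potential shows that
`∑ cap(uv) d(u, v) < φ ∑ Dᵢ d(sᵢ, tᵢ)`
(`CommodityNetwork.exists_potential_of_notMem_flowValues`). Taking the metric from the potentials
makes shortest paths and assumptions of connectedness unnecessary.

For a real function `h` on the vertices, integrating `γ dem(S) ≤ cap(S)` over the superlevel sets
`S` of `h` gives `γ ∑ Dᵢ |h(sᵢ) - h(tᵢ)| ≤ ∑ cap(uv) |h(u) - h(v)|`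
(`CommodityNetwork.mul_sum_demand_mul_le`). This is applied to the functions `h = d(·, A)`, for
random sets `A` of terminals of density `2⁻¹, 2⁻², …, 2⁻ᴶ`. They are `1`-Lipschitz, so each density
contributes at most `∑ cap(uv) d(u, v)` on the right. By Bourgain's argument the expectations of
`|h(sᵢ) - h(tᵢ)|`, summed over the `J` densities, are at least `d(sᵢ, tᵢ) / 24`
(`dist_le_sum_meanDistDiff`). Hence `γ ∑ Dᵢ d(sᵢ, tᵢ) ≤ 24 J ∑ cap(uv) d(u, v)`, a contradiction.
Only the at most `2 k` terminals enter the embedding, so `J = O(log k)` scales suffice.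
-/

/-! ### Random subsets -/

section RandomSubset

variable {E : Type*}

/-- The probability of the outcome `A` when each element of `T` is kept independently with
probability `p`. -/
noncomputable def subsetWeight (p : ℝ) (T A : Finset E) : ℝ :=
  p ^ A.card * (1 - p) ^ (T.card - A.card)

theorem subsetWeight_nonneg {p : ℝ} (h0 : 0 ≤ p) (h1 : p ≤ 1) (T A : Finset E) :
    0 ≤ subsetWeight p T A :=
  mul_nonneg (pow_nonneg h0 _) (pow_nonneg (by linarith) _)

theorem sum_subsetWeight (p : ℝ) (T : Finset E) :
    ∑ A ∈ T.powerset, subsetWeight p T A = 1 := by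
  simp [subsetWeight, Finset.sum_pow_mul_eq_add_pow]

/-- The probability that a random subset of `T` misses `X`. -/
theorem sum_subsetWeight_sdiff [DecidableEq E] (p : ℝ) {T X : Finset E} (hX : X ⊆ T) :
    ∑ A ∈ (T \ X).powerset, subsetWeight p T A = (1 - p) ^ X.card := by
  have h : ∀ A ∈ (T \ X).powerset, subsetWeight p T A =
      (1 - p) ^ X.card * (p ^ A.card * (1 - p) ^ ((T \ X).card - A.card)) := by
    intro A hA
    have h1 := Finset.card_le_card (Finset.mem_powerset.1 hA)
    have h2 := Finset.card_sdiff_add_card_eq_card hX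
    have h3 : T.card - A.card = X.card + ((T \ X).card - A.card) := by omega
    rw [subsetWeight, h3, pow_add]
    ring
  rw [Finset.sum_congr rfl h, ← Finset.mul_sum, Finset.sum_pow_mul_eq_add_pow]
  simp

/-- A lower bound for the mean of `g` through the event that the random subset misses `X` and
meets `Y`. -/
theorem mul_le_sum_subsetWeight_mul [DecidableEq E] {p : ℝ} (h0 : 0 ≤ p) (h1 : p ≤ 1)
    {T X Y : Finset E} (hX : X ⊆ T) (hY : Y ⊆ T) (hXY : Disjoint X Y)
    {g : Finset E → ℝ} (hg : ∀ A, 0 ≤ g A) {δ : ℝ}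
    (hδ : ∀ A ⊆ T, Disjoint A X → ¬ Disjoint A Y → δ ≤ g A) :
    ((1 - p) ^ X.card - (1 - p) ^ (X.card + Y.card)) * δ ≤
      ∑ A ∈ T.powerset, subsetWeight p T A * g A := by
  have hsub : (T \ (X ∪ Y)).powerset ⊆ (T \ X).powerset :=
    Finset.powerset_mono.2 (Finset.sdiff_subset_sdiff le_rfl Finset.subset_union_left)
  have e1 := sum_subsetWeight_sdiff p hX
  have e2 := sum_subsetWeight_sdiff p (Finset.union_subset hX hY)
  have e3 := Finset.sum_sdiff (f := subsetWeight p T) hsub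
  rw [Finset.card_union_of_disjoint hXY] at e2
  have e4 : (1 - p) ^ X.card - (1 - p) ^ (X.card + Y.card) =
      ∑ A ∈ (T \ X).powerset \ (T \ (X ∪ Y)).powerset, subsetWeight p T A := by
    linarith
  rw [e4, Finset.sum_mul]
  calc _ ≤ ∑ A ∈ (T \ X).powerset \ (T \ (X ∪ Y)).powerset, subsetWeight p T A * g A := by
        refine Finset.sum_le_sum fun A hA => ?_
        refine mul_le_mul_of_nonneg_left ?_ (subsetWeight_nonneg h0 h1 _ _)
        simp only [Finset.mem_sdiff, Finset.mem_powerset, Finset.subset_sdiff,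
          Finset.disjoint_union_right] at hA
        exact hδ A hA.1.1 hA.1.2 fun h => hA.2 ⟨hA.1.1, hA.1.2, h⟩
    _ ≤ _ := by
        refine Finset.sum_le_sum_of_subset_of_nonneg ?_ fun A _ _ =>
          mul_nonneg (subsetWeight_nonneg h0 h1 _ _) (hg A)
        exact Finset.sdiff_subset.trans (Finset.powerset_mono.2 Finset.sdiff_subset)

/-- If `X` has at most `2 n` points and `Y` at least `n`, a random set of density `1 / (2 n)` misses
`X` and meets `Y` with probability at least `1 / 12`. -/
theorem one_twelfth_le_pow_sub_pow {n a b : ℕ} (hn : 0 < n) (ha : a ≤ 2 * n) (hb : n ≤ b) :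
    (1 / 12 : ℝ) ≤ (1 - 1 / (2 * n)) ^ a - (1 - 1 / (2 * n)) ^ (a + b) := by
  have hn' : (1 : ℝ) ≤ n := by exact_mod_cast hn
  set t : ℝ := 1 / (2 * n) with ht
  have ht0 : 0 < t := by positivity
  have htn : n * t = 1 / 2 := by rw [ht]; field_simp
  have ht1 : t ≤ 1 / 2 := by nlinarith
  have hq0 : 0 ≤ 1 - t := by linarith
  have hq1 : 1 - t ≤ 1 := by linarith
  have lo : 1 / 2 ≤ (1 - t) ^ n := by
    have := one_add_mul_le_pow (a := -t) (by linarith) n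
    rw [← sub_eq_add_neg] at this
    linarith
  have hi : (1 - t) ^ n ≤ 2 / 3 := by
    have h1 := one_add_mul_le_pow (a := t) (by linarith) n
    have h2 : (1 - t) ^ n * (1 + t) ^ n ≤ 1 := by
      rw [← mul_pow]
      exact pow_le_one₀ (by nlinarith) (by nlinarith)
    nlinarith [pow_nonneg hq0 n]
  have h2n : 1 / 4 ≤ (1 - t) ^ a := by
    have h1 : (1 - t) ^ (2 * n) ≤ (1 - t) ^ a := pow_le_pow_of_le_one hq0 hq1 ha
    have h2 : (1 - t) ^ (2 * n) = (1 - t) ^ n * (1 - t) ^ n := by rw [two_mul, pow_add]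
    nlinarith
  have hb' : (1 - t) ^ b ≤ 2 / 3 := (pow_le_pow_of_le_one hq0 hq1 hb).trans hi
  rw [pow_add]
  nlinarith

end RandomSubset

/-! ### Distances to random sets of terminals -/

section Bourgain

variable {E : Type*} [PseudoMetricSpace E]

/-- The mean of `|d(x, A) - d(y, A)|` over random subsets `A` of `T` of density `2⁻¹⁻ʲ`. For `A = ∅`
the distance is `0` by convention, which does no harm. -/
noncomputable def meanDistDiff (T : Finset E) (j : ℕ) (x y : E) : ℝ :=
  ∑ A ∈ T.powerset, subsetWeight (1 / (2 * (2 ^ j : ℕ))) T A *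
    |Metric.infDist x A - Metric.infDist y A|

theorem density_nonneg (j : ℕ) : (0 : ℝ) ≤ 1 / (2 * (2 ^ j : ℕ)) := by positivity

theorem density_le_one (j : ℕ) : (1 : ℝ) / (2 * (2 ^ j : ℕ)) ≤ 1 := by
  have : (1 : ℝ) ≤ (2 ^ j : ℕ) := by exact_mod_cast Nat.one_le_two_pow
  rw [div_le_one (by linarith)]
  linarith

theorem meanDistDiff_nonneg (T : Finset E) (j : ℕ) (x y : E) : 0 ≤ meanDistDiff T j x y :=
  Finset.sum_nonneg fun _ _ =>
    mul_nonneg (subsetWeight_nonneg (density_nonneg j) (density_le_one j) _ _) (abs_nonneg _)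

theorem meanDistDiff_comm (T : Finset E) (j : ℕ) (x y : E) :
    meanDistDiff T j x y = meanDistDiff T j y x := by
  simp only [meanDistDiff, abs_sub_comm]

/-- Scale `j` separates `x` and `y` when the ball about `x` is sparse and the disjoint ball about
`y` is dense. -/
theorem sub_le_meanDistDiff (T : Finset E) (j : ℕ) {x y : E} {r r' : ℝ} (hr : r' ≤ r)
    (hrr : r + r' ≤ dist x y) (hx : (T.filter (dist · x < r)).card < 2 ^ (j + 1))
    (hy : 2 ^ j ≤ (T.filter (dist · y < r')).card) :
    r - r' ≤ 12 * meanDistDiff T j x y := by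
  classical
  have hdisj : Disjoint (T.filter (dist · x < r)) (T.filter (dist · y < r')) := by
    refine Finset.disjoint_left.2 fun z hz hz' => ?_
    rw [Finset.mem_filter] at hz hz'
    have := dist_triangle_left x y z
    linarith [hz.2, hz'.2]
  have key := mul_le_sum_subsetWeight_mul (density_nonneg j) (density_le_one j)
    (Finset.filter_subset (dist · x < r) T) (Finset.filter_subset (dist · y < r') T) hdisj
    (g := fun A => |Metric.infDist x A - Metric.infDist y A|) (fun _ => abs_nonneg _)
    (δ := r - r') (by
      intro A hA hAX hAY
      obtain ⟨z, hzA, hz⟩ := Finset.not_disjoint_iff.1 hAY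
      have h1 : Metric.infDist y A ≤ r' := by
        refine (Metric.infDist_le_dist_of_mem (Finset.mem_coe.2 hzA)).trans ?_
        rw [dist_comm]
        exact (Finset.mem_filter.1 hz).2.le
      have h2 : r ≤ Metric.infDist x A := by
        refine (Metric.le_infDist ⟨z, Finset.mem_coe.2 hzA⟩).2 fun w hw => ?_
        by_contra! hlt
        rw [dist_comm] at hlt
        exact Finset.disjoint_left.1 hAX (Finset.mem_coe.1 hw)
          (Finset.mem_filter.2 ⟨hA (Finset.mem_coe.1 hw), hlt⟩)
      exact le_trans (by linarith) (le_abs_self _))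
  have hp := one_twelfth_le_pow_sub_pow (n := 2 ^ j) (by positivity)
    (hx.le.trans_eq (pow_succ' 2 j)) hy
  have := mul_le_mul_of_nonneg_right hp (sub_nonneg.2 hr)
  change _ ≤ meanDistDiff T j x y at key
  linarith

/-- The lower bound in Bourgain's embedding theorem: the scales together recover a constant fraction
of the distance between two points of `T`. Let `ρ j` be the largest radius up to `d(x, y) / 2` at
which one of the balls about `x` and `y` has fewer than `2 ^ j` points. Scale `j` contributes a
multiple of `ρ (j + 1) - ρ j`, and these differences telescope. -/
theorem dist_le_sum_meanDistDiff (T : Finset E) {J : ℕ} (hJ : T.card < 2 ^ J) {x y : E}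
    (hx : x ∈ T) (hy : y ∈ T) :
    dist x y ≤ 24 * ∑ j ∈ Finset.range J, meanDistDiff T j x y := by
  let S : ℕ → Set ℝ := fun j => {r | 0 ≤ r ∧ r ≤ dist x y / 2 ∧
    ((T.filter (dist · x < r)).card < 2 ^ j ∨ (T.filter (dist · y < r)).card < 2 ^ j)}
  have hbdd : ∀ j, BddAbove (S j) := fun j => ⟨dist x y / 2, fun r hr => hr.2.1⟩
  have hzero : ∀ j, (0 : ℝ) ∈ S j := by
    intro j
    refine ⟨le_rfl, by positivity, Or.inl ?_⟩
    have : T.filter (dist · x < 0) = ∅ :=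
      Finset.filter_eq_empty_iff.2 fun z _ => not_lt.2 dist_nonneg
    rw [this]
    positivity
  have hstep : ∀ j, sSup (S (j + 1)) - sSup (S j) ≤ 12 * meanDistDiff T j x y := by
    intro j
    rw [sub_le_iff_le_add]
    refine csSup_le ⟨0, hzero _⟩ fun r hr => ?_
    by_contra! hlt
    have hE := meanDistDiff_nonneg T j x y
    -- A radius strictly between `ρ j` and `r - 12 * meanDistDiff T j x y`.
    obtain ⟨r', h1, h2⟩ := exists_between (show sSup (S j) < r - 12 * meanDistDiff T j x y by
      linarith)
    have hr'0 : 0 ≤ r' := (le_csSup (hbdd j) (hzero j)).trans h1.le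
    have hr' : r' ∉ S j := fun h => absurd (le_csSup (hbdd j) h) (not_le.2 h1)
    have hr2 := hr.2.1
    have hdense : 2 ^ j ≤ (T.filter (dist · x < r')).card ∧
        2 ^ j ≤ (T.filter (dist · y < r')).card := by
      by_contra h
      exact hr' ⟨hr'0, by linarith, by simpa only [not_and_or, not_le] using h⟩
    rcases hr.2.2 with h | h
    · have := sub_le_meanDistDiff T j (by linarith) (by linarith) h hdense.2
      linarith
    · have := sub_le_meanDistDiff T j (y := x) (x := y) (r := r) (r' := r') (by linarith)
        (by rw [dist_comm]; linarith) h hdense.1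
      rw [meanDistDiff_comm] at this
      linarith
  have h0 : sSup (S 0) ≤ 0 := by
    refine csSup_le ⟨0, hzero _⟩ fun r hr => ?_
    by_contra! hpos
    rcases hr.2.2 with h | h
    · have : x ∈ T.filter (dist · x < r) := Finset.mem_filter.2 ⟨hx, by simpa using hpos⟩
      have := Finset.card_pos.2 ⟨x, this⟩
      omega
    · have : y ∈ T.filter (dist · y < r) := Finset.mem_filter.2 ⟨hy, by simpa using hpos⟩
      have := Finset.card_pos.2 ⟨y, this⟩
      omega
  have hlast : dist x y / 2 ≤ sSup (S J) :=
    le_csSup (hbdd J) ⟨by positivity, le_rfl,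
      Or.inl ((Finset.card_le_card (Finset.filter_subset _ _)).trans_lt hJ)⟩
  have hsum := Finset.sum_le_sum fun j (_ : j ∈ Finset.range J) => hstep j
  rw [Finset.sum_range_sub (fun j => sSup (S j)), ← Finset.mul_sum] at hsum
  linarith

end Bourgain

/-! ### Edge capacities and demands -/

namespace CommodityNetwork

variable {V : Type*} {k : ℕ}

open Classical in
/-- The capacity of the edge `uv`, or `0` if `u` and `v` are not adjacent. -/
noncomputable def edgeCap (N : CommodityNetwork V k) (u v : V) : ℝ :=
  if N.graph.Adj u v then N.cap s(u, v) else 0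

theorem edgeCap_nonneg (N : CommodityNetwork V k) (u v : V) : 0 ≤ N.edgeCap u v := by
  unfold edgeCap
  split_ifs with h
  · exact N.cap_nonneg _ h
  · exact le_rfl

theorem edgeCap_comm (N : CommodityNetwork V k) (u v : V) : N.edgeCap u v = N.edgeCap v u := by
  by_cases h : N.graph.Adj u v
  · simp [edgeCap, h, h.symm, Sym2.eq_swap (a := u) (b := v)]
  · simp [edgeCap, h, mt SimpleGraph.Adj.symm h]

theorem cutDem_nonneg (N : CommodityNetwork V k) (S : Finset V) : 0 ≤ N.cutDem S :=
  Finset.sum_nonneg fun i _ => by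
    split_ifs
    exacts [(N.demand_pos i).le, le_rfl]

open Classical in
theorem cutDem_pos (N : CommodityNetwork V k) {S : Finset V}
    (h : ∃ i, Separates S (N.source i) (N.sink i)) : 0 < N.cutDem S := by
  obtain ⟨i, hi⟩ := h
  refine Finset.sum_pos' (fun i _ => ?_) ⟨i, Finset.mem_univ _, by simp [hi, N.demand_pos i]⟩
  split_ifs
  exacts [(N.demand_pos i).le, le_rfl]

/-! ### Duality -/

/-- The flows that respect the capacities, with no condition on conservation. -/
def admissible (N : CommodityNetwork V k) : Set (Fin k → V → V → ℝ) :=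
  {f | (∀ i u v, 0 ≤ f i u v) ∧ (∀ i u v, ¬ N.graph.Adj u v → f i u v = 0) ∧
    ∀ u v, N.graph.Adj u v → ∑ i, (f i u v + f i v u) ≤ N.cap s(u, v)}

theorem convex_admissible (N : CommodityNetwork V k) : Convex ℝ N.admissible := by
  intro f hf g hg a b ha hb hab
  refine ⟨fun i u v => ?_, fun i u v h => ?_, fun u v h => ?_⟩
  · exact add_nonneg (mul_nonneg ha (hf.1 i u v)) (mul_nonneg hb (hg.1 i u v))
  · simp [hf.2.1 i u v h, hg.2.1 i u v h]
  · have h1 := mul_le_mul_of_nonneg_left (hf.2.2 u v h) ha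
    have h2 := mul_le_mul_of_nonneg_left (hg.2.2 u v h) hb
    have h3 : ∑ i, ((a • f + b • g) i u v + (a • f + b • g) i v u) =
        a * ∑ i, (f i u v + f i v u) + b * ∑ i, (g i u v + g i v u) := by
      rw [Finset.mul_sum, Finset.mul_sum, ← Finset.sum_add_distrib]
      refine Finset.sum_congr rfl fun i _ => ?_
      simp only [Pi.add_apply, Pi.smul_apply, smul_eq_mul]
      ring
    rw [h3]
    calc _ ≤ a * N.cap s(u, v) + b * N.cap s(u, v) := add_le_add h1 h2
      _ = _ := by rw [← add_mul, hab, one_mul]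

theorem isCompact_admissible (N : CommodityNetwork V k) : IsCompact N.admissible := by
  refine IsCompact.of_isClosed_subset
    (isCompact_univ_pi fun i : Fin k => isCompact_univ_pi fun u : V =>
      isCompact_univ_pi fun v : V => isCompact_Icc (a := (0 : ℝ)) (b := N.edgeCap u v)) ?_ ?_
  · simp only [admissible, Set.ofPred_and, Set.ofPred_forall]
    refine IsClosed.inter ?_ (IsClosed.inter ?_ ?_)
    · exact isClosed_iInter fun i => isClosed_iInter fun u => isClosed_iInter fun v =>
        isClosed_le continuous_const (by fun_prop)
    · exact isClosed_iInter fun i => isClosed_iInter fun u => isClosed_iInter fun v =>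
        isClosed_iInter fun _ => isClosed_eq (by fun_prop) continuous_const
    · exact isClosed_iInter fun u => isClosed_iInter fun v =>
        isClosed_iInter fun _ => isClosed_le (by fun_prop) continuous_const
  · intro f hf i _ u _ v _
    refine ⟨hf.1 i u v, ?_⟩
    unfold edgeCap
    split_ifs with h
    · refine le_trans ?_ (hf.2.2 u v h)
      have := Finset.single_le_sum (f := fun i => f i u v + f i v u)
        (fun j _ => add_nonneg (hf.1 j u v) (hf.1 j v u)) (Finset.mem_univ i)
      linarith [hf.1 i v u]
    · exact (hf.2.1 i u v h).le

variable [Fintype V]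

/-- Counting each edge once, in its downhill direction, is half of counting it in both directions. -/
theorem sum_edgeCap_mul_posPart (N : CommodityNetwork V k) (g : V → V → ℝ)
    (hg : ∀ u v, g v u = - g u v) :
    ∑ u, ∑ v, N.edgeCap u v * max (g u v) 0 = (∑ u, ∑ v, N.edgeCap u v * |g u v|) / 2 := by
  have h1 : ∑ u, ∑ v, N.edgeCap u v * max (g u v) 0 =
      ∑ u, ∑ v, N.edgeCap u v * max (- g u v) 0 := by
    rw [Finset.sum_comm]
    refine Finset.sum_congr rfl fun u _ => Finset.sum_congr rfl fun v _ => ?_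
    rw [edgeCap_comm, hg]
  have h2 : ∑ u, ∑ v, N.edgeCap u v * |g u v| =
      ∑ u, ∑ v, N.edgeCap u v * max (g u v) 0 + ∑ u, ∑ v, N.edgeCap u v * max (- g u v) 0 := by
    simp only [← Finset.sum_add_distrib, ← mul_add]
    refine Finset.sum_congr rfl fun u _ => Finset.sum_congr rfl fun v _ => ?_
    rcases le_total 0 (g u v) with h | h
    · rw [abs_of_nonneg h, max_eq_left h, max_eq_right (by linarith), add_zero]
    · rw [abs_of_nonpos h, max_eq_right h, max_eq_left (by linarith), zero_add]
  linarith

theorem isCompact_flowValues (N : CommodityNetwork V k) (i₀ : Fin k) :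
    IsCompact N.flowValues := by
  -- The value of a flow can be read off from the commodity `i₀`.
  let ψ : (Fin k → V → V → ℝ) → ℝ := fun f =>
    (∑ v, f i₀ (N.source i₀) v - ∑ v, f i₀ v (N.source i₀)) / N.demand i₀
  have hψ : Continuous ψ := by fun_prop
  let K : Set (Fin k → V → V → ℝ) := N.admissible ∩ {f | 0 ≤ ψ f ∧
    (∀ i v, v ≠ N.source i → v ≠ N.sink i → ∑ u, f i u v = ∑ u, f i v u) ∧
    ∀ i, ∑ v, f i (N.source i) v - ∑ v, f i v (N.source i) = ψ f * N.demand i}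
  have hK : IsCompact K := by
    refine N.isCompact_admissible.inter_right ?_
    simp only [Set.ofPred_and, Set.ofPred_forall]
    refine IsClosed.inter (isClosed_le continuous_const hψ) (IsClosed.inter ?_ ?_)
    · exact isClosed_iInter fun i => isClosed_iInter fun v => isClosed_iInter fun _ =>
        isClosed_iInter fun _ => isClosed_eq (by fun_prop) (by fun_prop)
    · exact isClosed_iInter fun i => isClosed_eq (by fun_prop) (by fun_prop)
  convert hK.image hψ using 1
  ext φ
  constructor
  · rintro ⟨h0, f, hf⟩
    have h : ψ f = φ := by
      simp only [ψ, hf.value i₀]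
      exact mul_div_cancel_right₀ _ (N.demand_pos i₀).ne'
    refine ⟨f, ⟨⟨hf.nonneg, hf.eq_zero_of_not_adj, hf.capacity⟩, ?_⟩, h⟩
    simp only [Set.mem_ofPred_eq, h]
    exact ⟨h0, hf.conservation, hf.value⟩
  · rintro ⟨f, ⟨hf, h0, hc, hv⟩, rfl⟩
    exact ⟨h0, f, hf.1, hf.2.1, hc, hv, hf.2.2⟩

theorem zero_mem_flowValues (N : CommodityNetwork V k) : (0 : ℝ) ∈ N.flowValues :=
  ⟨le_rfl, 0, by
    constructor <;> simp
    exact fun u v h => N.cap_nonneg _ h⟩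

/-- The net amount of each commodity that leaves each vertex. -/
noncomputable def netOut (V : Type*) [Fintype V] (k : ℕ) :
    (Fin k → V → V → ℝ) →ₗ[ℝ] (Fin k → V → ℝ) where
  toFun f i v := ∑ u, f i v u - ∑ u, f i u v
  map_add' f g := by
    ext i v
    simp only [Pi.add_apply, Finset.sum_add_distrib]
    ring
  map_smul' a f := by
    ext i v
    simp only [Pi.smul_apply, smul_eq_mul, ← Finset.mul_sum, RingHom.id_apply]
    ring

/-- Summation by parts. -/
theorem sum_netOut_mul (f : Fin k → V → V → ℝ) (p : Fin k → V → ℝ) :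
    ∑ i, ∑ v, netOut V k f i v * p i v = ∑ u, ∑ v, ∑ i, f i u v * (p i u - p i v) := by
  have h : ∀ i, ∑ v, netOut V k f i v * p i v = ∑ u, ∑ v, f i u v * (p i u - p i v) := by
    intro i
    simp only [netOut, LinearMap.coe_mk, AddHom.coe_mk, sub_mul, mul_sub, Finset.sum_sub_distrib,
      Finset.sum_mul]
    congr 1
    exact Finset.sum_comm
  rw [Finset.sum_congr rfl fun i _ => h i, Finset.sum_comm]
  exact Finset.sum_congr rfl fun u _ => Finset.sum_comm

/-- For given potentials, some admissible flow uses the whole capacity of each edge for the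
commodity with the largest difference of potential on it, in the downhill direction. -/
theorem exists_admissible_sum_eq (N : CommodityNetwork V k) (i₀ : Fin k) (p : Fin k → V → ℝ) :
    ∃ f ∈ N.admissible, (∑ u, ∑ v, N.edgeCap u v * dist (fun i => p i u) (fun i => p i v)) / 2 ≤
      ∑ u, ∑ v, ∑ i, f i u v * (p i u - p i v) := by
  classical
  have : Nonempty (Fin k) := ⟨i₀⟩
  -- The commodity is chosen by the unordered pair, so that both directions of an edge agree on it.
  have hbest : ∀ e : Sym2 V, ∃ i, ∀ u v, e = s(u, v) → ∀ j, |p j u - p j v| ≤ |p i u - p i v| := by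
    intro e
    induction e with
    | _ a b =>
      obtain ⟨i, hi⟩ := Finite.exists_max fun j => |p j a - p j b|
      refine ⟨i, fun u v h j => ?_⟩
      rcases Sym2.eq_iff.1 h with ⟨rfl, rfl⟩ | ⟨rfl, rfl⟩
      · exact hi j
      · rw [abs_sub_comm (p j b), abs_sub_comm (p i b)]
        exact hi j
  choose best hbest using hbest
  refine ⟨fun i u v => if i = best s(u, v) ∧ p i v < p i u then N.edgeCap u v else 0,
    ⟨fun i u v => ?_, fun i u v h => ?_, fun u v h => ?_⟩, ?_⟩
  · dsimp only
    split_ifs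
    exacts [N.edgeCap_nonneg u v, le_rfl]
  · simp [edgeCap, h]
  · have hc : N.edgeCap u v = N.cap s(u, v) := by simp [edgeCap, h]
    rw [Finset.sum_eq_single (best s(u, v))]
    · dsimp only
      rw [edgeCap_comm N v u, hc, Sym2.eq_swap (a := v) (b := u)]
      have : 0 ≤ N.cap s(u, v) := N.cap_nonneg _ (N.graph.mem_edgeSet.2 h)
      split_ifs with h1 h2 h2
      · exact absurd h1.2 h2.2.not_gt
      all_goals simp [this]
    · intro i _ hi
      simp [hi, Sym2.eq_swap (a := v) (b := u)]
    · simp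
  · have hsum : ∀ u v, ∑ i, (if i = best s(u, v) ∧ p i v < p i u then N.edgeCap u v else 0) *
        (p i u - p i v) = N.edgeCap u v * max (p (best s(u, v)) u - p (best s(u, v)) v) 0 := by
      intro u v
      rw [Finset.sum_eq_single (best s(u, v))]
      · split_ifs with h
        · rw [max_eq_left (by linarith [h.2])]
        · rw [max_eq_right (by simpa using h), zero_mul, mul_zero]
      · intro i _ hi
        simp [hi]
      · simp
    simp only [hsum]
    rw [sum_edgeCap_mul_posPart N fun u v => p (best s(u, v)) u - p (best s(u, v)) v]
    · refine div_le_div_of_nonneg_right ?_ zero_le_two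
      refine Finset.sum_le_sum fun u _ => Finset.sum_le_sum fun v _ => ?_
      refine mul_le_mul_of_nonneg_left ?_ (N.edgeCap_nonneg u v)
      refine (dist_pi_le_iff (abs_nonneg _)).2 fun j => ?_
      rw [Real.dist_eq]
      exact hbest _ u v rfl j
    · intro u v
      rw [Sym2.eq_swap (a := v) (b := u)]
      ring

/-- Linear programming duality: if the value `φ` is not achieved, a family of potentials witnesses
this. The length of an edge is its distance in the supremum metric of the potentials. -/
theorem exists_potential_of_notMem_flowValues (N : CommodityNetwork V k) (i₀ : Fin k) {φ : ℝ}
    (h0 : 0 ≤ φ) (hφ : φ ∉ N.flowValues) :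
    ∃ P : V → Fin k → ℝ, (∑ u, ∑ v, N.edgeCap u v * dist (P u) (P v)) / 2 <
      φ * ∑ i, N.demand i * dist (P (N.source i)) (P (N.sink i)) := by
  classical
  let b : Fin k → V → ℝ := fun i v => φ * N.demand i *
    ((if v = N.source i then 1 else 0) - if v = N.sink i then 1 else 0)
  have hb : b ∉ netOut V k '' N.admissible := by
    rintro ⟨f, hf, hfb⟩
    have hnet : ∀ i v, ∑ u, f i v u - ∑ u, f i u v = b i v := fun i v =>
      congrFun (congrFun hfb i) v
    refine hφ ⟨h0, f, hf.1, hf.2.1, fun i v h1 h2 => ?_, fun i => ?_, hf.2.2⟩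
    · have := hnet i v
      simp only [b, h1, h2, if_false, sub_self, mul_zero] at this
      linarith
    · rw [hnet]
      simp [b, N.source_ne_sink i]
  obtain ⟨L, a, hL, ha⟩ := geometric_hahn_banach_closed_point
    (N.convex_admissible.linear_image (netOut V k))
    ((N.isCompact_admissible.image (netOut V k).continuous_of_finiteDimensional).isClosed) hb
  let p : Fin k → V → ℝ := fun i v => L (Pi.single i (Pi.single v 1))
  have hLp : ∀ y : Fin k → V → ℝ, L y = ∑ i, ∑ v, y i v * p i v := by
    intro y
    have : y = ∑ i, ∑ v, y i v • (Pi.single i (Pi.single v 1) : Fin k → V → ℝ) := by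
      ext i v
      simp only [Finset.sum_apply, Pi.smul_apply, smul_eq_mul]
      rw [Finset.sum_eq_single i (fun j _ hj => by simp [Pi.single_eq_of_ne hj.symm]) (by simp),
        Finset.sum_eq_single v (fun w _ hw => by simp [Pi.single_eq_of_ne hw.symm]) (by simp)]
      simp
    conv_lhs => rw [this]
    simp [map_sum, p]
  obtain ⟨f, hf, hfp⟩ := N.exists_admissible_sum_eq i₀ p
  refine ⟨fun v i => p i v, ?_⟩
  have h1 := hL _ ⟨f, hf, rfl⟩
  rw [hLp, sum_netOut_mul] at h1
  refine (hfp.trans_lt (h1.trans ha)).trans_le ?_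
  rw [hLp, Finset.mul_sum]
  refine Finset.sum_le_sum fun i _ => ?_
  have h2 : ∑ v, b i v * p i v = φ * N.demand i * (p i (N.source i) - p i (N.sink i)) := by
    simp [b, mul_assoc, ← Finset.mul_sum, sub_mul, Finset.sum_sub_distrib]
  rw [h2, mul_assoc]
  refine mul_le_mul_of_nonneg_left (mul_le_mul_of_nonneg_left ?_ (N.demand_pos i).le) h0
  refine (le_abs_self _).trans ?_
  rw [← Real.dist_eq]
  exact dist_le_pi_dist (fun j => p j (N.source i)) (fun j => p j (N.sink i)) i

/-! ### Cuts -/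

theorem cutCap_nonneg (N : CommodityNetwork V k) (S : Finset V) : 0 ≤ N.cutCap S :=
  Finset.sum_nonneg fun u _ => Finset.sum_nonneg fun v _ => N.edgeCap_nonneg u v

theorem exists_isLeast_cutRatios (N : CommodityNetwork V k) (i₀ : Fin k) :
    ∃ γ, IsLeast N.cutRatios γ := by
  have hfin : N.cutRatios.Finite :=
    (Set.toFinite {S : Finset V | ∃ i, Separates S (N.source i) (N.sink i)}).image N.cutRatio
  have hne : N.cutRatios.Nonempty :=
    ⟨_, {N.source i₀}, ⟨i₀, Or.inl ⟨by simp, by simpa using (N.source_ne_sink i₀).symm⟩⟩, rfl⟩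
  obtain ⟨γ, hγ, h⟩ := Set.exists_min_image _ id hfin hne
  exact ⟨γ, hγ, h⟩

theorem mul_cutDem_le_cutCap (N : CommodityNetwork V k) {γ : ℝ} (hγ : γ ∈ lowerBounds N.cutRatios)
    (S : Finset V) : γ * N.cutDem S ≤ N.cutCap S := by
  classical
  by_cases h : ∃ i, Separates S (N.source i) (N.sink i)
  · exact (le_div_iff₀ (N.cutDem_pos h)).1 (hγ ⟨S, h, rfl⟩)
  · have : N.cutDem S = 0 :=
      Finset.sum_eq_zero fun i _ => if_neg fun hi => h ⟨i, hi⟩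
    rw [this, mul_zero]
    exact N.cutCap_nonneg S

/-- The cut inequality for all superlevel sets of `h`, integrated over the level. -/
theorem mul_sum_demand_mul_le (N : CommodityNetwork V k) {γ : ℝ}
    (hγ : γ ∈ lowerBounds N.cutRatios) (h : V → ℝ) :
    γ * ∑ i, N.demand i * |h (N.source i) - h (N.sink i)| ≤
      (∑ u, ∑ v, N.edgeCap u v * |h u - h v|) / 2 := by
  classical
  let χ : ℝ → ℝ → ℝ → ℝ := fun a b => (Set.Ico a b).indicator 1
  have hχint : ∀ a b, MeasureTheory.Integrable (χ a b) := fun a b =>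
    (MeasureTheory.integrable_indicator_iff measurableSet_Ico).2
      (MeasureTheory.integrableOn_const (by simp))
  have hχ : ∀ a b, ∫ t, χ a b t = max (b - a) 0 := by
    intro a b
    rw [MeasureTheory.integral_indicator_one measurableSet_Ico]
    simp [MeasureTheory.measureReal_def, ENNReal.toReal_ofReal']
  let S : ℝ → Finset V := fun t => Finset.univ.filter fun v => t < h v
  have hcap : ∀ t, N.cutCap (S t) = ∑ u, ∑ v, N.edgeCap u v * χ (h v) (h u) t := by
    intro t
    simp only [cutCap, S, Finset.sum_filter, Finset.compl_filter]
    refine Finset.sum_congr rfl fun u _ => ?_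
    split_ifs with hu
    · refine Finset.sum_congr rfl fun v _ => ?_
      by_cases hv : h v ≤ t
      · simp [χ, edgeCap, hu, hv]
      · simp [χ, hv]
    · simp [χ, hu]
  have hdem : ∀ t, N.cutDem (S t) = ∑ i, N.demand i *
      (χ (h (N.sink i)) (h (N.source i)) t + χ (h (N.source i)) (h (N.sink i)) t) := by
    intro t
    refine Finset.sum_congr rfl fun i _ => ?_
    simp only [Separates, S, Finset.mem_filter, Finset.mem_univ, true_and, χ, Set.indicator_apply,
      Set.mem_Ico, Pi.one_apply]
    by_cases h1 : t < h (N.source i) <;> by_cases h2 : t < h (N.sink i) <;>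
      simp [h1, h2, not_lt.1, not_le.2]
  have hmono : ∫ t, γ * ∑ i, N.demand i *
        (χ (h (N.sink i)) (h (N.source i)) t + χ (h (N.source i)) (h (N.sink i)) t) ≤
      ∫ t, ∑ u, ∑ v, N.edgeCap u v * χ (h v) (h u) t := by
    refine MeasureTheory.integral_mono ?_ ?_ fun t => ?_
    · exact (MeasureTheory.integrable_finsetSum _ fun i _ =>
        ((hχint _ _).add (hχint _ _)).const_mul _).const_mul _
    · exact MeasureTheory.integrable_finsetSum _ fun u _ =>
        MeasureTheory.integrable_finsetSum _ fun v _ => (hχint _ _).const_mul _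
    · dsimp only
      rw [← hcap, ← hdem]
      exact N.mul_cutDem_le_cutCap hγ (S t)
  have hint : ∀ i ∈ Finset.univ, MeasureTheory.Integrable fun t => N.demand i *
      (χ (h (N.sink i)) (h (N.source i)) t + χ (h (N.source i)) (h (N.sink i)) t) :=
    fun i _ => ((hχint _ _).add (hχint _ _)).const_mul _
  rw [MeasureTheory.integral_const_mul, MeasureTheory.integral_finsetSum _ hint,
    MeasureTheory.integral_finsetSum _ fun u _ =>
      MeasureTheory.integrable_finsetSum _ fun v _ => (hχint _ _).const_mul _] at hmono
  rw [← sum_edgeCap_mul_posPart N (fun u v => h u - h v) fun u v => by ring]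
  convert hmono using 2
  · refine Finset.sum_congr rfl fun i _ => ?_
    rw [MeasureTheory.integral_const_mul, MeasureTheory.integral_add (hχint _ _) (hχint _ _), hχ,
      hχ]
    congr 1
    rcases le_total (h (N.source i)) (h (N.sink i)) with h' | h'
    · rw [abs_of_nonpos (by linarith), max_eq_right (by linarith), max_eq_left (by linarith)]
      ring
    · rw [abs_of_nonneg (by linarith), max_eq_left (by linarith), max_eq_right (by linarith)]
      ring
  · rw [MeasureTheory.integral_finsetSum _ fun v _ => (hχint _ _).const_mul _]
    refine Finset.sum_congr rfl fun v _ => ?_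
    rw [MeasureTheory.integral_const_mul, hχ]

/-! ### The flow-cut gap -/

/-- Averaging the cut inequality over the functions `d(·, A)`, which are `1`-Lipschitz, at all
scales. -/
theorem mul_sum_demand_mul_dist_le (N : CommodityNetwork V k) {γ : ℝ} (hγ0 : 0 ≤ γ)
    (hγ : γ ∈ lowerBounds N.cutRatios) {E : Type*} [PseudoMetricSpace E] (P : V → E) {J : ℕ}
    (hJ : 2 * k < 2 ^ J) :
    γ * ∑ i, N.demand i * dist (P (N.source i)) (P (N.sink i)) ≤
      24 * J * ((∑ u, ∑ v, N.edgeCap u v * dist (P u) (P v)) / 2) := by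
  classical
  let T : Finset E := Finset.univ.image (fun i => P (N.source i)) ∪
    Finset.univ.image (fun i => P (N.sink i))
  have hT : T.card < 2 ^ J := by
    refine lt_of_le_of_lt ((Finset.card_union_le _ _).trans ?_) hJ
    have h1 := Finset.card_image_le (s := Finset.univ) (f := fun i => P (N.source i))
    have h2 := Finset.card_image_le (s := Finset.univ) (f := fun i => P (N.sink i))
    simp only [Finset.card_univ, Fintype.card_fin] at h1 h2
    omega
  set L := (∑ u, ∑ v, N.edgeCap u v * dist (P u) (P v)) / 2 with hL
  have hA : ∀ A : Finset E, γ * ∑ i, N.demand i * |Metric.infDist (P (N.source i)) A -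
      Metric.infDist (P (N.sink i)) A| ≤ L := by
    intro A
    refine (N.mul_sum_demand_mul_le hγ fun v => Metric.infDist (P v) A).trans ?_
    refine div_le_div_of_nonneg_right ?_ zero_le_two
    refine Finset.sum_le_sum fun u _ => Finset.sum_le_sum fun v _ => ?_
    refine mul_le_mul_of_nonneg_left ?_ (N.edgeCap_nonneg u v)
    rw [← Real.dist_eq]
    simpa using (Metric.lipschitz_infDist_pt (A : Set E)).dist_le_mul (P u) (P v)
  have hj : ∀ j, γ * ∑ i, N.demand i * meanDistDiff T j (P (N.source i)) (P (N.sink i)) ≤ L := by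
    intro j
    calc _ = ∑ A ∈ T.powerset, subsetWeight (1 / (2 * (2 ^ j : ℕ))) T A *
          (γ * ∑ i, N.demand i * |Metric.infDist (P (N.source i)) A -
            Metric.infDist (P (N.sink i)) A|) := by
          simp only [meanDistDiff, Finset.mul_sum]
          rw [Finset.sum_comm]
          refine Finset.sum_congr rfl fun A _ => Finset.sum_congr rfl fun i _ => ?_
          ring
      _ ≤ ∑ A ∈ T.powerset, subsetWeight (1 / (2 * (2 ^ j : ℕ))) T A * L :=
          Finset.sum_le_sum fun A _ => mul_le_mul_of_nonneg_left (hA A)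
            (subsetWeight_nonneg (density_nonneg j) (density_le_one j) _ _)
      _ = L := by rw [← Finset.sum_mul, sum_subsetWeight, one_mul]
  calc _ ≤ γ * ∑ i, N.demand i * (24 * ∑ j ∈ Finset.range J,
        meanDistDiff T j (P (N.source i)) (P (N.sink i))) := by
        refine mul_le_mul_of_nonneg_left (Finset.sum_le_sum fun i _ => ?_) hγ0
        refine mul_le_mul_of_nonneg_left ?_ (N.demand_pos i).le
        exact dist_le_sum_meanDistDiff T hT
          (Finset.mem_union_left _ (Finset.mem_image_of_mem _ (Finset.mem_univ i)))
          (Finset.mem_union_right _ (Finset.mem_image_of_mem _ (Finset.mem_univ i)))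
    _ = 24 * ∑ j ∈ Finset.range J,
        γ * ∑ i, N.demand i * meanDistDiff T j (P (N.source i)) (P (N.sink i)) := by
        simp only [Finset.mul_sum]
        rw [Finset.sum_comm]
        refine Finset.sum_congr rfl fun j _ => Finset.sum_congr rfl fun i _ => ?_
        ring
    _ ≤ 24 * ∑ j ∈ Finset.range J, L := by
        refine mul_le_mul_of_nonneg_left (Finset.sum_le_sum fun j _ => hj j) (by norm_num)
    _ = _ := by
        rw [Finset.sum_const, Finset.card_range, nsmul_eq_mul]
        ring

theorem div_mem_flowValues (N : CommodityNetwork V k) (i₀ : Fin k) {γ : ℝ} (hγ0 : 0 ≤ γ)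
    (hγ : γ ∈ lowerBounds N.cutRatios) {J : ℕ} (hJ : 2 * k < 2 ^ J) :
    γ / (24 * J) ∈ N.flowValues := by
  by_contra hφ
  have hJ0 : 0 < J := by
    rcases Nat.eq_zero_or_pos J with rfl | h
    · have := i₀.pos
      omega
    · exact h
  have hJ' : (0 : ℝ) < 24 * J := by positivity
  obtain ⟨P, hP⟩ := N.exists_potential_of_notMem_flowValues i₀ (by positivity) hφ
  have h := N.mul_sum_demand_mul_dist_le hγ0 hγ P hJ
  rw [div_mul_eq_mul_div, lt_div_iff₀ hJ'] at hP
  linarith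

end CommodityNetwork

/-- The number of scales that `2 * k` terminals need is `O(log k)`. -/
theorem natLog_add_two_le {k : ℕ} (hk : 2 ≤ k) :
    ((Nat.log 2 k + 2 : ℕ) : ℝ) ≤ 6 * Real.log k := by
  have h1 : Real.log 2 ≤ Real.log k := Real.log_le_log (by norm_num) (by exact_mod_cast hk)
  have h2 : Nat.log 2 k * Real.log 2 ≤ Real.log k := by
    rw [← Real.log_pow]
    refine Real.log_le_log (by positivity) ?_
    exact_mod_cast Nat.pow_log_le_self 2 (by omega)
  have h3 := Real.log_two_gt_d9
  push_cast
  nlinarith [(Nat.cast_nonneg (Nat.log 2 k) : (0 : ℝ) ≤ _)]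

/-- The maximum concurrent flow and the minimum cut ratio exist, and the former is at least a
universal constant times the latter divided by `log k`. -/
theorem theorem4p1 :
    ∃ c : ℝ, 0 < c ∧
      ∀ (k : ℕ), 2 ≤ k → ∀ (V : Type*) [Fintype V] (N : CommodityNetwork V k),
        ∃ φ γ : ℝ, IsGreatest N.flowValues φ ∧ IsLeast N.cutRatios γ ∧
          c * (γ / Real.log k) ≤ φ := by
  -- `24` is the loss of the embedding, and `6 * log k` bounds the number of scales.
  refine ⟨1 / 144, by norm_num, fun k hk V _ N => ?_⟩
  let i₀ : Fin k := ⟨0, by omega⟩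
  obtain ⟨φ, hφ⟩ := (N.isCompact_flowValues i₀).exists_isGreatest ⟨0, N.zero_mem_flowValues⟩
  obtain ⟨γ, hγ⟩ := N.exists_isLeast_cutRatios i₀
  refine ⟨φ, γ, hφ, hγ, ?_⟩
  have hγ0 : 0 ≤ γ := by
    obtain ⟨S, -, rfl⟩ := hγ.1
    exact div_nonneg (N.cutCap_nonneg S) (N.cutDem_nonneg S)
  have hJ : 2 * k < 2 ^ (Nat.log 2 k + 2) := by
    have := Nat.lt_pow_succ_log_self (b := 2) (by norm_num) k
    rw [pow_succ]
    omega
  refine le_trans ?_ (hφ.2 (N.div_mem_flowValues i₀ hγ0 hγ.2 hJ))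
  have hlog := natLog_add_two_le hk
  have hpos : (0 : ℝ) < (Nat.log 2 k + 2 : ℕ) := by positivity
  calc 1 / 144 * (γ / Real.log k) = γ / (24 * (6 * Real.log k)) := by
        rw [one_div, ← div_eq_inv_mul, div_div]
        congr 1
        ring
    _ ≤ γ / (24 * (Nat.log 2 k + 2 : ℕ)) :=
        div_le_div_of_nonneg_left hγ0 (by positivity) (by linarith)
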